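/- Let $G$ be an additive abelian group all of whose finite subgroups are cyclic. Let $n>1$, let $A_1,\dots,A_n$ be finite subsets of $G$, each of cardinality $k\ge n$, and let $b_1,\dots,b_n\in G$. Let $m$ be a positive integer with $m\le (k-1)/(n-1)$. (i) If $b_1,\dots,b_n$ are pairwise distinct, then there are at least $(k-1)n-m\binom n2+1$ multisets $\{a_1,\dots,a_n\}$ such that $a_i\in A_i$ for $i=1,\dots,n$ and the elements $ma_1+b_1,\dots,ma_n+b_n$ are pairwise distinct. (ii) Suppose that either $b_1,\dots,b_n$ are pairwise distinct and all of odd (finite) order, or $b_1,\dots,b_n$ all have finite order and $n!$ cannot be written in the form $\sum_{p\in P}p\,x_p$ with all $x_p$ nonnegative integers, where $P$ is the set of primes dividing the order of at least one of $b_1,\dots,b_n$. Then each of the two families of sets $$\bigl\{\{a_1,\dots,a_n\}:\ a_i\in A_i,\ a_i\ne a_j \text{ and } ma_i+b_i\ne ma_j+b_j \text{ if } i\ne j\bigr\}$$ and $$\bigl\{\{a_1,\dots,a_n\}:\ a_i\in A_i,\ ma_i\ne ma_j \text{ and } a_i+b_i\ne a_j+b_j \text{ if } i\ne j\bigr\}$$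 has more than $(k-1)n-(m+1)\binom n2$ elements. Moreover, $(k-1)n-(m+1)\binom n2\ge (m-1)\binom n2$. -/

import Mathlib

/-- The multisets `{a 0, …, a (n-1)}` with `a i ∈ A i` such that all the `m • a i + b i`
are pairwise distinct. -/
def multisetFamily {G : Type*} [AddCommGroup G] {n : ℕ} (A : Fin n → Finset G)
    (b : Fin n → G) (m : ℕ) : Set (Multiset G) :=
  {s | ∃ a : Fin n → G, (∀ i, a i ∈ A i) ∧
    (∀ i j, i ≠ j → m • a i + b i ≠ m • a j + b j) ∧
    s = Multiset.map a Finset.univ.val}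

/-- The sets `{a 0, …, a (n-1)}` with `a i ∈ A i` such that `a i ≠ a j` and
`m • a i + b i ≠ m • a j + b j` whenever `i ≠ j`. -/
def setFamilyOne {G : Type*} [AddCommGroup G] {n : ℕ} (A : Fin n → Finset G)
    (b : Fin n → G) (m : ℕ) : Set (Set G) :=
  {s | ∃ a : Fin n → G, (∀ i, a i ∈ A i) ∧
    (∀ i j, i ≠ j → a i ≠ a j ∧ m • a i + b i ≠ m • a j + b j) ∧
    s = Set.range a}

/-- The sets `{a 0, …, a (n-1)}` with `a i ∈ A i` such that `m • a i ≠ m • a j` and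
`a i + b i ≠ a j + b j` whenever `i ≠ j`. -/
def setFamilyTwo {G : Type*} [AddCommGroup G] {n : ℕ} (A : Fin n → Finset G)
    (b : Fin n → G) (m : ℕ) : Set (Set G) :=
  {s | ∃ a : Fin n → G, (∀ i, a i ∈ A i) ∧
    (∀ i j, i ≠ j → m • a i ≠ m • a j ∧ a i + b i ≠ a j + b j) ∧
    s = Set.range a}

/-- The set of primes dividing the order of at least one `b i` (used only when every `b i`
has finite order, that is, when no `addOrderOf (b i)` is zero). -/
noncomputable def orderPrimes {G : Type*} [AddCommGroup G] {n : ℕ} (b : Fin n → G) : Finset ℕ :=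
  Finset.univ.biUnion fun i => (addOrderOf (b i)).primeFactors

/-- The integers of the form `∑ p ∈ P, p * x p` with all `x p` nonnegative integers. -/
def natCombinations (P : Finset ℕ) : Set ℕ :=
  {N | ∃ x : ℕ → ℕ, N = ∑ p ∈ P, p * x p}

/-!
The subgroup `H` generated by the sets `A i` and the elements `b i` is finitely generated with
finite cyclic torsion, hence embeds into `ℂˣ` by some `e` (`exists_isMulEmbeddingOn`). Distinct
values of `∑ e (a i)` come from distinct members of the families, so it suffices to count these sums
of complex numbers subject to the restriction that a polynomial `P` does not vanish at
`(e (a i))`. Here `P` is `∏ (β j * X j ^ m - β i * X i ^ m)` over `i < j` with `β i = e (b i)`, in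
part (ii) multiplied by `∏ (X j - X i)`, or with the exponents `m` and `1` exchanged. By the
polynomial method (`lt_card_of_restricted_sums_mem`) there are more than `n (k - 1) - deg P` such
sums, provided that the coefficient of `∏ X i ^ (k - 1)` in `P * (∑ X i) ^ (n (k - 1) - deg P)`
is nonzero.

Both factors of `P` are Vandermonde determinants, and expanding them computes that coefficient. In
part (i) it is a nonzero rational multiple of the Vandermonde determinant of the `β i`
(`coeff_vandermondePoly_mul_sum_X_pow`). In part (ii) the double sum over permutations separates
into a nonzero rational determinant (`det_recipFactorial_ne_zero`, where `m (n - 1) ≤ k - 1` is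
used) and the *permanent* of the Vandermonde matrix of the `β i`
(`coeff_vandermondePoly_mul_vandermondePoly_mul_sum_X_pow`). This permanent does not vanish:

* if the `b i` are distinct of odd order, because modulo a prime above `2` it agrees with the
  Vandermonde determinant (`permanent_vandermonde_ne_zero_of_odd`);
* if `n!` is not a combination of the primes dividing the orders of the `b i`, because of the
  theorem of Lam and Leung on the possible numbers of terms in a vanishing sum of roots of unity
  (`card_mem_closure_primeFactors_of_sum_eq_zero`).

The theorem of Lam and Leung is proved for pairs of multisets of `m`-th roots of unity with equal
sums (`EqualSumsDichotomy`), by adjoining to `m` one prime `ℓ` at a time. If `ℓ ∣ m`, the sums agree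
on each coset of the `m`-th roots of unity; if `ℓ ∤ m`, they differ on all cosets by one and the
same number. In the latter case `y` misses some coset `i₀`, and each coset part `x j` has the same
sum as `x i₀ + y j`; either all these comparisons give differences of cardinalities in the
semigroup, and one adds them up, or one of them makes `x` so large that nothing is left to prove.
-/

/-! ### The polynomial method for restricted sumsets -/

open MvPolynomial in
/-- Translating the linear form `∑ X i` by constants does not affect the top degree: a
coefficient of degree `d + card s` of `P * ∏ c ∈ s, (∑ X i - c)` does not depend on the constants
in `s` if `P` has degree at most `d`. -/
theorem coeff_mul_prod_sum_X_sub_C {σ F : Type*} [Fintype σ] [Field F] (s : Multiset F) (d : ℕ)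
    (P : MvPolynomial σ F) (hP : P.totalDegree ≤ d) (t : σ →₀ ℕ)
    (ht : t.degree = d + s.card) :
    coeff t (P * (s.map fun c => (∑ i, X i) - C c).prod) =
      coeff t (P * (∑ i, X i) ^ s.card) := by
  have hX : (∑ i, X i : MvPolynomial σ F).totalDegree ≤ 1 :=
    totalDegree_finsetSum_le fun i _ => (totalDegree_X i).le
  induction s using Multiset.induction_on generalizing d P with
  | empty => simp
  | cons c s ih =>
    rw [Multiset.card_cons] at ht ⊢
    rw [Multiset.map_cons, Multiset.prod_cons, ← mul_assoc]
    have hP' : (P * ((∑ i, X i) - C c)).totalDegree ≤ d + 1 := by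
      refine (totalDegree_mul _ _).trans (add_le_add hP ((totalDegree_sub _ _).trans ?_))
      simpa using hX
    have hlow : coeff t (P * (∑ i, X i) ^ s.card) = 0 := by
      refine coeff_eq_zero_of_totalDegree_lt ?_
      have h1 : (P * (∑ i, X i) ^ s.card).totalDegree ≤ d + s.card := by
        refine (totalDegree_mul _ _).trans (add_le_add hP ((totalDegree_pow _ _).trans ?_))
        simpa using Nat.mul_le_mul_left s.card hX
      have h2 : t.degree = ∑ i ∈ t.support, t i := rfl
      omega
    rw [ih (d + 1) _ hP' (by omega), mul_sub, sub_mul, coeff_sub, mul_right_comm P (C c),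
      mul_comm _ (C c), coeff_C_mul, hlow, mul_zero, sub_zero, pow_succ', mul_assoc]

open MvPolynomial in
/-- The Alon–Nathanson–Ruzsa form of the combinatorial Nullstellensatz: if `P` has degree at most
`d` and some coefficient of degree `d + N` of `P * (∑ X i) ^ N` is nonzero, with exponents smaller
than the sizes of the sets `A i`, then the restricted sumset
`{∑ a i | a i ∈ A i, P a ≠ 0}` has more than `N` elements. -/
theorem lt_card_of_restricted_sums_mem {σ F : Type*} [Fintype σ] [Field F] (P : MvPolynomial σ F)
    (d N : ℕ) (hP : P.totalDegree ≤ d) (t : σ →₀ ℕ) (ht : t.degree = d + N)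
    (hcoeff : coeff t (P * (∑ i, X i) ^ N) ≠ 0) (A : σ → Finset F) (hA : ∀ i, t i < (A i).card)
    (E : Finset F) (hE : ∀ a : σ → F, (∀ i, a i ∈ A i) → eval a P ≠ 0 → ∑ i, a i ∈ E) :
    N < E.card := by
  by_contra! hlt
  -- Padding by zeros gives exactly `N` linear factors, one vanishing at each element of `E`.
  set s : Multiset F := E.val + Multiset.replicate (N - E.card) 0 with hs
  have hcard : s.card = N := by
    rw [hs, Multiset.card_add, Multiset.card_replicate, Finset.card_val]
    omega
  have hX : (∑ i, X i : MvPolynomial σ F).totalDegree ≤ 1 :=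
    totalDegree_finsetSum_le fun i _ => (totalDegree_X i).le
  set Q : MvPolynomial σ F := P * (s.map fun c => (∑ i, X i) - C c).prod with hQ
  have hQc : coeff t Q ≠ 0 := by
    rw [hQ, coeff_mul_prod_sum_X_sub_C s d P hP t (by omega), hcard]
    exact hcoeff
  have hQd : Q.totalDegree = t.degree := by
    refine le_antisymm ?_ (le_totalDegree (mem_support_iff.mpr hQc))
    rw [ht, hQ]
    refine (totalDegree_mul _ _).trans (add_le_add hP ?_)
    refine (totalDegree_multiset_prod _).trans ?_
    rw [Multiset.map_map, ← hcard]
    refine (Multiset.sum_le_card_nsmul _ 1 ?_).trans (by simp)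
    intro x hx
    obtain ⟨c, -, rfl⟩ := Multiset.mem_map.mp hx
    refine (totalDegree_sub _ _).trans ?_
    simpa using hX
  obtain ⟨a, haA, ha⟩ := combinatorial_nullstellensatz_exists_eval_nonzero Q t hQc hQd A hA
  rw [hQ, map_mul] at ha
  have hmem := hE a haA (left_ne_zero_of_mul ha)
  refine right_ne_zero_of_mul ha ?_
  rw [map_multiset_prod, Multiset.map_map]
  refine Multiset.prod_eq_zero (Multiset.mem_map.mpr ⟨∑ i, a i, ?_, by simp⟩)
  exact Multiset.mem_add.mpr (Or.inl hmem)

/-! ### Coefficients of Vandermonde products times powers of a linear form -/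

/-- The weight `κ (κ - 1) ⋯ (κ - e + 1) / κ!`, which equals `1 / (κ - e)!` when `e ≤ κ` and `0`
otherwise; thus it is the reciprocal factorial of `κ - e`, without truncation. -/
noncomputable def recipFactorial (κ e : ℕ) : ℂ := (κ.descFactorial e : ℂ) / (κ.factorial : ℂ)

theorem recipFactorial_of_le {κ e : ℕ} (h : e ≤ κ) :
    recipFactorial κ e = ((κ - e).factorial : ℂ)⁻¹ := by
  have h1 : ((κ - e).factorial : ℂ) * κ.descFactorial e = κ.factorial := by
    exact_mod_cast Nat.factorial_mul_descFactorial h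
  have h2 : ((κ - e).factorial : ℂ) ≠ 0 := by exact_mod_cast Nat.factorial_ne_zero _
  have h3 : (κ.factorial : ℂ) ≠ 0 := by exact_mod_cast Nat.factorial_ne_zero _
  rw [recipFactorial]
  field_simp
  rw [mul_comm]
  exact h1

theorem recipFactorial_of_lt {κ e : ℕ} (h : κ < e) : recipFactorial κ e = 0 := by
  rw [recipFactorial, Nat.descFactorial_of_lt h]
  simp

open MvPolynomial in
theorem coeff_monomial_mul_sum_X_pow {n : ℕ} (κ N : ℕ) (e : Fin n →₀ ℕ) (a : ℂ)
    (he : e.degree + N = n * κ) :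
    coeff (Finsupp.equivFunOnFinite.symm fun _ : Fin n => κ)
        (monomial e a * (∑ i, X i) ^ N) =
      a * (N.factorial * ∏ i, recipFactorial κ (e i)) := by
  set t : Fin n →₀ ℕ := Finsupp.equivFunOnFinite.symm fun _ : Fin n => κ with ht
  have hti : ∀ i, t i = κ := fun i => rfl
  rw [coeff_monomial_mul']
  have hS : (∑ i, X i : MvPolynomial (Fin n) ℂ) = ∑ i, (1 : ℂ) • X i := by simp
  split_ifs with hle
  · have hsum : ∑ i, (t - e) i = N := by
      rw [Finsupp.degree_eq_sum] at he
      have h1 : ∑ i, ((t - e) i + e i) = n * κ := by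
        rw [Finset.sum_congr rfl fun i _ => show (t - e) i + e i = κ from ?_]
        · simp
        · have := hle i
          rw [hti] at this
          rw [Finsupp.tsub_apply, hti]
          omega
      rw [Finset.sum_add_distrib] at h1
      omega
    rw [hS, coeff_linearCombination_X_pow_of_fintype, if_pos]
    · congr 1
      have h1 : ((t - e).multinomial : ℂ) * ∏ i, (((t - e) i).factorial : ℂ) = N.factorial := by
        rw [← Finsupp.multinomial_of_support_subset (Finset.subset_univ (t - e).support), ← hsum,
          ← Nat.multinomial_spec, mul_comm]
        push_cast
        rfl
      have h2 : ∏ i, recipFactorial κ (e i) = (∏ i, (((t - e) i).factorial : ℂ))⁻¹ := by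
        rw [← Finset.prod_inv_distrib]
        refine Finset.prod_congr rfl fun i _ => ?_
        rw [recipFactorial_of_le (by have := hle i; rwa [hti] at this), Finsupp.tsub_apply, hti]
      have h3 : ∏ i, (((t - e) i).factorial : ℂ) ≠ 0 :=
        Finset.prod_ne_zero_iff.mpr fun i _ => by exact_mod_cast Nat.factorial_ne_zero _
      rw [h2, ← h1]
      field_simp
      simp [Finsupp.prod]
    · rw [Finsupp.sum_fintype _ _ (by simp), hsum]
  · rw [Finsupp.le_def, not_forall] at hle
    obtain ⟨i, hi⟩ := hle
    rw [Finset.prod_eq_zero (Finset.mem_univ i), mul_zero, mul_zero]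
    exact recipFactorial_of_lt (by rw [hti] at hi; omega)

open MvPolynomial in
/-- The product `∏ (c j * X j ^ r - c i * X i ^ r)` over `i < j`, written as a Vandermonde
determinant. -/
noncomputable def vandermondePoly {n : ℕ} (c : Fin n → ℂ) (r : ℕ) : MvPolynomial (Fin n) ℂ :=
  (Matrix.vandermonde fun i => C (c i) * X i ^ r).det

open MvPolynomial in
theorem eval_vandermondePoly_ne_zero_iff {n : ℕ} (c : Fin n → ℂ) (r : ℕ) (x : Fin n → ℂ) :
    eval x (vandermondePoly c r) ≠ 0 ↔ Function.Injective fun i => c i * x i ^ r := by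
  rw [← Matrix.det_vandermonde_ne_zero_iff, vandermondePoly, Matrix.det_vandermonde,
    Matrix.det_vandermonde]
  simp

/-- The exponent vector `i ↦ r * σ i`. -/
noncomputable def permExponent {n : ℕ} (r : ℕ) (σ : Equiv.Perm (Fin n)) : Fin n →₀ ℕ :=
  Finsupp.equivFunOnFinite.symm fun i => r * (σ i : ℕ)

theorem degree_permExponent {n : ℕ} (r : ℕ) (σ : Equiv.Perm (Fin n)) :
    (permExponent r σ).degree = r * n.choose 2 := by
  rw [Finsupp.degree_eq_sum]
  change ∑ i, r * (σ i : ℕ) = _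
  rw [← Finset.mul_sum, Equiv.sum_comp σ fun i => (i : ℕ), Fin.sum_univ_eq_sum_range fun i => i,
    Finset.sum_range_id, Nat.choose_two_right]

open MvPolynomial in
theorem vandermondePoly_eq_sum {n : ℕ} (c : Fin n → ℂ) (r : ℕ) :
    vandermondePoly c r = ∑ σ : Equiv.Perm (Fin n),
      monomial (permExponent r σ) (((Equiv.Perm.sign σ : ℤ) : ℂ) * ∏ i, c i ^ (σ i : ℕ)) := by
  rw [vandermondePoly, ← Matrix.det_transpose, Matrix.det_apply']
  refine Finset.sum_congr rfl fun σ _ => ?_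
  rw [← C_mul_monomial, monomial_eq, Finsupp.prod_fintype _ _ (by simp)]
  simp only [Matrix.transpose_apply, Matrix.vandermonde_apply, mul_pow, Finset.prod_mul_distrib,
    map_prod, map_pow, ← pow_mul]
  rw [map_intCast]
  congr 1

open MvPolynomial in
theorem totalDegree_vandermondePoly_le {n : ℕ} (c : Fin n → ℂ) (r : ℕ) :
    (vandermondePoly c r).totalDegree ≤ r * n.choose 2 := by
  rw [vandermondePoly_eq_sum]
  refine totalDegree_finsetSum_le fun σ _ => (totalDegree_monomial_le _ _).trans ?_
  rw [← degree_permExponent r σ]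
  exact le_rfl

open MvPolynomial in
theorem coeff_vandermondePoly_mul_sum_X_pow {n : ℕ} (c : Fin n → ℂ) (m κ N : ℕ)
    (hN : m * n.choose 2 + N = n * κ) :
    coeff (Finsupp.equivFunOnFinite.symm fun _ : Fin n => κ)
        (vandermondePoly c m * (∑ i, X i) ^ N) =
      (Matrix.vandermonde c).det * (N.factorial * ∏ i : Fin n, recipFactorial κ (m * i)) := by
  rw [vandermondePoly_eq_sum, Finset.sum_mul, coeff_sum, ← Matrix.det_transpose, Matrix.det_apply',
    Finset.sum_mul]
  refine Finset.sum_congr rfl fun σ _ => ?_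
  rw [coeff_monomial_mul_sum_X_pow _ _ _ _ (by rw [degree_permExponent, hN])]
  simp only [Matrix.transpose_apply, Matrix.vandermonde_apply]
  congr 2
  exact Equiv.prod_comp σ fun i : Fin n => recipFactorial κ (m * (i : ℕ))

/-- Substituting `σ = ρ * τ` separates a double alternating sum into a permanent and a
determinant. -/
theorem sum_sum_sign_mul_eq_permanent_mul_det {n : ℕ} (c : Fin n → ℂ) (f : Fin n → Fin n → ℂ) :
    ∑ σ : Equiv.Perm (Fin n), ∑ τ : Equiv.Perm (Fin n),
      ((Equiv.Perm.sign σ : ℤ) : ℂ) * (((Equiv.Perm.sign τ : ℤ) : ℂ) * ∏ i, c i ^ (τ i : ℕ)) *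
        ∏ i, f (σ i) (τ i) =
      (Matrix.vandermonde c).transpose.permanent * (Matrix.of f).det := by
  rw [Finset.sum_comm, Matrix.permanent, Matrix.det_apply', Finset.sum_mul_sum]
  refine Finset.sum_congr rfl fun τ _ => ?_
  rw [← Equiv.sum_comp (Equiv.mulRight τ)]
  refine Finset.sum_congr rfl fun ρ _ => ?_
  have h1 : (((Equiv.Perm.sign τ : ℤˣ) : ℤ) : ℂ) * (((Equiv.Perm.sign τ : ℤˣ) : ℤ) : ℂ) = 1 := by
    rw [← Int.cast_mul, ← Units.val_mul, Int.units_mul_self]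
    simp
  have h2 : ∏ i, f ((ρ * τ) i) (τ i) = ∏ i, f (ρ i) i := Equiv.prod_comp τ fun i => f (ρ i) i
  simp only [Equiv.coe_mulRight, h2, Equiv.Perm.sign_mul, Units.val_mul, Int.cast_mul,
    Matrix.transpose_apply, Matrix.vandermonde_apply, Matrix.of_apply]
  linear_combination (((Equiv.Perm.sign ρ : ℤˣ) : ℤ) : ℂ) * (∏ i, c i ^ (τ i : ℕ)) *
    (∏ i, f (ρ i) i) * h1

open MvPolynomial in
theorem coeff_vandermondePoly_mul_vandermondePoly_mul_sum_X_pow {n : ℕ} (c : Fin n → ℂ)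
    (r s κ N : ℕ) (hN : (r + s) * n.choose 2 + N = n * κ) :
    coeff (Finsupp.equivFunOnFinite.symm fun _ : Fin n => κ)
        (vandermondePoly 1 r * vandermondePoly c s * (∑ i, X i) ^ N) =
      N.factorial * ((Matrix.vandermonde c).transpose.permanent *
        (Matrix.of fun i j : Fin n => recipFactorial κ (r * i + s * j)).det) := by
  rw [← sum_sum_sign_mul_eq_permanent_mul_det, vandermondePoly_eq_sum, vandermondePoly_eq_sum,
    Finset.sum_mul_sum, Finset.sum_mul, coeff_sum, Finset.mul_sum]
  refine Finset.sum_congr rfl fun σ _ => ?_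
  rw [Finset.sum_mul, coeff_sum, Finset.mul_sum]
  refine Finset.sum_congr rfl fun τ _ => ?_
  rw [monomial_mul, coeff_monomial_mul_sum_X_pow _ _ _ _
    (by rw [map_add, degree_permExponent, degree_permExponent, ← hN]; ring)]
  simp only [Pi.one_apply, one_pow, Finset.prod_const_one, mul_one]
  rw [mul_left_comm]
  rfl

/-- With `c j = κ - m * j`, the matrix `1 / (κ - i - m * j)!` is, up to scaling its columns, the
matrix of falling factorials `(c j) (c j - 1) ⋯ (c j - i + 1)`, so its determinant is a nonzero
multiple of the Vandermonde determinant of the distinct numbers `c j`. -/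
theorem det_recipFactorial_ne_zero {n : ℕ} (m κ : ℕ) (hm : 0 < m) (hκ : m * (n - 1) ≤ κ) :
    (Matrix.of fun i j : Fin n => recipFactorial κ (i + m * j)).det ≠ 0 := by
  have hle : ∀ j : Fin n, m * (j : ℕ) ≤ κ := fun j =>
    (Nat.mul_le_mul_left m (by omega)).trans hκ
  have hM : (Matrix.of fun i j : Fin n => recipFactorial κ (i + m * j)) =
      Matrix.of fun i j : Fin n => recipFactorial κ (m * j) *
        (Matrix.of fun (a b : Fin n) =>
          (descPochhammer ℂ b).eval (((κ - m * a : ℕ) : ℂ))).transpose i j := by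
    ext i j
    simp only [Matrix.of_apply, Matrix.transpose_apply, recipFactorial]
    rw [descPochhammer_eval_eq_descFactorial, add_comm, ← Nat.descFactorial_mul_descFactorial
      (Nat.le_add_right (m * (j : ℕ)) i), Nat.add_sub_cancel_left]
    push_cast
    ring
  rw [hM, Matrix.det_mul_row, Matrix.det_transpose,
    ← Matrix.det_eval_matrixOfPolynomials_eq_det_vandermonde _ _
      (fun i => descPochhammer_natDegree _ _) fun i => monic_descPochhammer _ _]
  refine mul_ne_zero (Finset.prod_ne_zero_iff.mpr fun j _ => ?_)
    (Matrix.det_vandermonde_ne_zero_iff.mpr fun i j hij => ?_)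
  · rw [recipFactorial_of_le (hle j)]
    exact inv_ne_zero (by exact_mod_cast Nat.factorial_ne_zero _)
  · have h1 : κ - m * i = κ - m * j := by exact_mod_cast hij
    have h2 := hle i
    have h3 := hle j
    exact Fin.ext (Nat.eq_of_mul_eq_mul_left hm (by omega))

/-! ### Permanents of Vandermonde matrices of roots of unity of odd order -/

/-- In characteristic two the permanent is the determinant. A maximal ideal of the ring of algebraic
integers that contains `2` keeps distinct roots of unity of odd order distinct, so there the
permanent reduces to a nonzero Vandermonde determinant. -/
theorem permanent_vandermonde_ne_zero_of_odd {n : ℕ} (c : Fin n → ℂ) (hc : Function.Injective c)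
    (M : ℕ) (hM : Odd M) (hcM : ∀ i, c i ^ M = 1) :
    (Matrix.vandermonde c).transpose.permanent ≠ 0 := by
  let R := integralClosure ℤ ℂ
  have hM0 : M ≠ 0 := fun h => by simp [h] at hM
  have hint : ∀ i, IsIntegral ℤ (c i) := fun i =>
    IsIntegral.of_pow (Nat.pos_of_ne_zero hM0) (by rw [hcM]; exact isIntegral_one)
  let c' : Fin n → R := fun i => ⟨c i, hint i⟩
  have hmax : (Ideal.span {(2 : ℤ)}).IsMaximal :=
    PrincipalIdealRing.isMaximal_of_irreducible Int.prime_two.irreducible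
  obtain ⟨Q, hQmax, hQ⟩ := Ideal.exists_ideal_over_maximal_of_isIntegral (S := R)
    (Ideal.span {(2 : ℤ)}) (by
      rw [(RingHom.injective_iff_ker_eq_bot _).mp (FaithfulSMul.algebraMap_injective ℤ R)]
      exact bot_le)
  let : Field (R ⧸ Q) := Ideal.Quotient.field Q
  set φ : R →+* R ⧸ Q := Ideal.Quotient.mk Q with hφ
  have hker : ∀ z : ℤ, ((z : R ⧸ Q) = 0 ↔ 2 ∣ z) := fun z => by
    rw [← Ideal.mem_span_singleton, ← hQ, Ideal.mem_comap, ← Ideal.Quotient.eq_zero_iff_mem]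
    simp
  have h2 : (1 : R ⧸ Q) = -1 := by
    have := (hker 2).mpr dvd_rfl
    push_cast at this
    linear_combination this
  have hMF : (M : R ⧸ Q) ≠ 0 := by
    intro h
    have h' := (hker (M : ℤ)).mp (by exact_mod_cast h)
    have : 2 ∣ M := by exact_mod_cast h'
    rw [← Nat.not_even_iff_odd, even_iff_two_dvd] at hM
    exact hM this
  have hc'M : ∀ i, c' i ^ M = 1 := fun i => Subtype.ext (hcM i)
  have hinj : Function.Injective fun i => φ (c' i) := by
    intro i j hij
    by_contra hne
    have hne' : c' i ≠ c' j := fun h => hne (hc (congrArg Subtype.val h))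
    -- Divide `(c i) ^ M - (c j) ^ M = 0` by `c i - c j`, then reduce.
    have hgeom : (∑ l ∈ Finset.range M, c' i ^ l * c' j ^ (M - 1 - l)) = 0 := by
      have h := geom_sum₂_mul (c' i) (c' j) M
      rw [hc'M, hc'M, sub_self] at h
      exact (mul_eq_zero.mp h).resolve_right (sub_ne_zero.mpr hne')
    have h := congrArg φ hgeom
    simp only at hij
    rw [map_sum, map_zero] at h
    rw [Finset.sum_congr rfl fun l hl => show φ (c' i ^ l * c' j ^ (M - 1 - l)) =
      φ (c' j) ^ (M - 1) by
        rw [map_mul, map_pow, map_pow, hij, ← pow_add]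
        congr 1
        have := Finset.mem_range.mp hl
        omega] at h
    rw [Finset.sum_const, Finset.card_range, nsmul_eq_mul] at h
    refine (mul_ne_zero hMF (pow_ne_zero _ fun h0 => ?_)) h
    have h1 := congrArg φ (hc'M j)
    rw [map_pow, h0, zero_pow hM0, map_one] at h1
    exact zero_ne_one h1
  have hdet := Matrix.det_vandermonde_ne_zero_iff.mpr hinj
  intro hper
  have hper' : (Matrix.vandermonde c').transpose.permanent = 0 := by
    apply Subtype.val_injective
    rw [← show (Matrix.vandermonde c).transpose.permanent =
      ((Matrix.vandermonde c').transpose.permanent : R) by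
        simp [Matrix.permanent, c'], hper]
    rfl
  refine hdet ?_
  rw [← Matrix.det_transpose, Matrix.det_apply', ← map_zero φ, ← hper', Matrix.permanent, map_sum]
  refine Finset.sum_congr rfl fun σ _ => ?_
  rw [map_prod]
  rcases Int.units_eq_one_or (Equiv.Perm.sign σ) with h | h <;> simp [h, ← h2]

/-! ### Linear independence of powers of roots of unity over cyclotomic fields -/

open IntermediateField in
theorem totient_le_totient_mul_natDegree_minpoly {m N : ℕ} (hm : 0 < m) (hN : 0 < N) {η ω ζ : ℂ}
    (hη : IsPrimitiveRoot η m) (hω : IsPrimitiveRoot ω N) (hζ : IsIntegral ℚ ζ)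
    (hmem : ω ∈ (ℚ⟮η⟯)⟮ζ⟯) :
    N.totient ≤ m.totient * (minpoly ℚ⟮η⟯ ζ).natDegree := by
  have hηi : IsIntegral ℚ η := (hη.isIntegral hm).tower_top
  have hωi : IsIntegral ℚ ω := (hω.isIntegral hN).tower_top
  have hζi : IsIntegral ℚ⟮η⟯ ζ := hζ.tower_top
  have h1 : Module.finrank ℚ ℚ⟮η⟯ = m.totient := by
    rw [adjoin.finrank hηi, ← Polynomial.cyclotomic_eq_minpoly_rat hη hm,
      Polynomial.natDegree_cyclotomic]
  have h2 : Module.finrank ℚ ℚ⟮ω⟯ = N.totient := by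
    rw [adjoin.finrank hωi, ← Polynomial.cyclotomic_eq_minpoly_rat hω hN,
      Polynomial.natDegree_cyclotomic]
  have h3 := adjoin.finrank hζi
  have : FiniteDimensional ℚ ℚ⟮η⟯ := adjoin.finiteDimensional hηi
  have : FiniteDimensional ℚ⟮η⟯ (ℚ⟮η⟯)⟮ζ⟯ := adjoin.finiteDimensional hζi
  have : FiniteDimensional ℚ (ℚ⟮η⟯)⟮ζ⟯ := FiniteDimensional.trans ℚ ℚ⟮η⟯ (ℚ⟮η⟯)⟮ζ⟯
  have h4 := Module.finrank_mul_finrank ℚ ℚ⟮η⟯ (ℚ⟮η⟯)⟮ζ⟯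
  rw [← h1, ← h2, ← h3, h4]
  have hle : ℚ⟮ω⟯ ≤ (ℚ⟮η⟯)⟮ζ⟯.restrictScalars ℚ := by
    rw [adjoin_simple_le_iff]
    exact hmem
  exact LinearMap.finrank_le_finrank_of_injective
    (f := (IntermediateField.inclusion hle).toLinearMap)
    (IntermediateField.inclusion_injective hle)

open IntermediateField in
theorem eq_zero_of_sum_mul_pow_eq_zero {η ζ : ℂ} {d : ℕ} (hd : d ≤ (minpoly ℚ⟮η⟯ ζ).natDegree)
    (c : ℕ → ℂ) (hc : ∀ i, c i ∈ ℚ⟮η⟯) (hsum : ∑ i ∈ Finset.range d, c i * ζ ^ i = 0) :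
    ∀ i < d, c i = 0 := by
  have hli := (linearIndependent_pow (K := ℚ⟮η⟯) ζ).comp (Fin.castLE hd) (Fin.castLE_injective hd)
  rw [Fintype.linearIndependent_iff] at hli
  intro i hi
  have h := hli (fun i => ⟨c i, hc i⟩) (by
    rw [← hsum, Finset.sum_range]
    rfl) ⟨i, hi⟩
  exact congrArg Subtype.val h

open IntermediateField in
/-- If `ℓ ∣ m`, then `1, ω, …, ω ^ (ℓ - 1)` are linearly independent over the field of `m`-th roots
of unity, where `ω` is a primitive root of order `ℓ * m`. -/
theorem eq_zero_of_sum_mul_pow_eq_zero_of_dvd {ℓ m : ℕ} (hℓ : ℓ.Prime) (hm : 0 < m) (hdvd : ℓ ∣ m)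
    {ω : ℂ} (hω : IsPrimitiveRoot ω (ℓ * m)) (c : ℕ → ℂ) (hc : ∀ i, c i ∈ ℚ⟮ω ^ ℓ⟯)
    (hsum : ∑ i ∈ Finset.range ℓ, c i * ω ^ i = 0) : ∀ i < ℓ, c i = 0 := by
  have hpos : 0 < ℓ * m := Nat.mul_pos hℓ.pos hm
  refine eq_zero_of_sum_mul_pow_eq_zero ?_ c hc hsum
  have h := totient_le_totient_mul_natDegree_minpoly hm hpos (hω.pow hpos rfl) hω
    (hω.isIntegral hpos).tower_top (mem_adjoin_simple_self _ ω)
  rw [Nat.totient_mul_of_prime_of_dvd hℓ hdvd, mul_comm] at h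
  exact Nat.le_of_mul_le_mul_left h (Nat.totient_pos.mpr hm)

open IntermediateField in
/-- If the prime `ℓ` does not divide `m`, then the only linear relations between
`1, ζ, …, ζ ^ (ℓ - 1)` over the field of `m`-th roots of unity are the multiples of
`1 + ζ + ⋯ + ζ ^ (ℓ - 1) = 0`, where `ζ` is a primitive root of order `ℓ`. -/
theorem eq_of_sum_mul_pow_eq_zero_of_not_dvd {ℓ m : ℕ} (hℓ : ℓ.Prime) (hm : 0 < m)
    (hdvd : ¬ ℓ ∣ m) {η ζ : ℂ} (hη : IsPrimitiveRoot η m) (hζ : IsPrimitiveRoot ζ ℓ) (c : ℕ → ℂ)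
    (hc : ∀ i, c i ∈ ℚ⟮η⟯) (hsum : ∑ i ∈ Finset.range ℓ, c i * ζ ^ i = 0) :
    ∀ i < ℓ, c i = c (ℓ - 1) := by
  have hcop : ℓ.Coprime m := (Nat.Prime.coprime_iff_not_dvd hℓ).mpr hdvd
  have hω : IsPrimitiveRoot (ζ * η) (ℓ * m) := by
    have := IsPrimitiveRoot.orderOf (ζ * η)
    rwa [(Commute.all ζ η).orderOf_mul_eq_mul_orderOf_of_coprime
      (by rwa [← hζ.eq_orderOf, ← hη.eq_orderOf]), ← hζ.eq_orderOf, ← hη.eq_orderOf] at this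
  have hdeg : ℓ - 1 ≤ (minpoly ℚ⟮η⟯ ζ).natDegree := by
    have h := totient_le_totient_mul_natDegree_minpoly hm (Nat.mul_pos hℓ.pos hm) hη hω
      (hζ.isIntegral hℓ.pos).tower_top
      (mul_mem (mem_adjoin_simple_self _ ζ)
        (IntermediateField.algebraMap_mem (ℚ⟮η⟯)⟮ζ⟯ (⟨η, mem_adjoin_simple_self ℚ η⟩ : ℚ⟮η⟯)))
    rw [Nat.totient_mul hcop, Nat.totient_prime hℓ, mul_comm] at h
    exact Nat.le_of_mul_le_mul_left h (Nat.totient_pos.mpr hm)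
  have hgeom := hζ.geom_sum_eq_zero hℓ.one_lt
  have hsub : ∑ i ∈ Finset.range (ℓ - 1), (c i - c (ℓ - 1)) * ζ ^ i = 0 := by
    have h : ∑ i ∈ Finset.range (ℓ - 1 + 1), (c i - c (ℓ - 1)) * ζ ^ i = 0 := by
      rw [Nat.sub_add_cancel hℓ.one_le]
      simp only [sub_mul, Finset.sum_sub_distrib, ← Finset.mul_sum, hsum, hgeom, mul_zero, sub_zero]
    rwa [Finset.sum_range_succ, sub_self, zero_mul, add_zero] at h
  intro i hi
  rcases Nat.lt_or_ge i (ℓ - 1) with h | h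
  · exact sub_eq_zero.mp (eq_zero_of_sum_mul_pow_eq_zero hdeg (fun i => c i - c (ℓ - 1))
      (fun i => sub_mem (hc i) (hc _)) hsub i h)
  · rw [show i = ℓ - 1 by omega]

/-! ### Vanishing sums of roots of unity -/

/-- The statement carried through the induction on `m` in the theorem of Lam and Leung, which is
its case `y = 0`. If two multisets `x` and `y` of
`m`-th roots of unity have the same sum, then either `card x - card y` is a nonnegative integer in
`S`, or `card x` is at least `(p - 1 - card y) * (q - 1)`. For `y = 0` the latter bound is the
Frobenius bound beyond which every integer is a combination of `p` and `q`. -/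
def EqualSumsDichotomy (p q : ℕ) (S : AddSubmonoid ℕ) (m : ℕ) : Prop :=
  ∀ x y : Multiset ℂ, (∀ z ∈ x, z ^ m = 1) → (∀ z ∈ y, z ^ m = 1) → x.sum = y.sum →
    (∃ t ∈ S, x.card = y.card + t) ∨ ((p : ℤ) - 1 - y.card) * ((q : ℤ) - 1) ≤ x.card

/-- If `ζ ^ m` is a primitive root of unity of prime order `ℓ`, then the cosets of the `m`-th roots
of unity in the `ℓ * m`-th ones are represented by `1, ζ, …, ζ ^ (ℓ - 1)`, so a multiset of
`ℓ * m`-th roots of unity splits into `ℓ` translates of multisets of `m`-th roots of unity. -/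
theorem exists_coset_decomposition {ℓ m : ℕ} (hℓ : 0 < ℓ) {ζ : ℂ} (hζ0 : ζ ≠ 0)
    (hζ : IsPrimitiveRoot (ζ ^ m) ℓ) (x : Multiset ℂ) (hx : ∀ z ∈ x, z ^ (ℓ * m) = 1) :
    ∃ f : ℕ → Multiset ℂ, (∀ i, ∀ z ∈ f i, z ^ m = 1) ∧
      x.sum = ∑ i ∈ Finset.range ℓ, (f i).sum * ζ ^ i ∧
      x.card = ∑ i ∈ Finset.range ℓ, (f i).card := by
  induction x using Multiset.induction_on with
  | empty => exact ⟨fun _ => 0, by simp⟩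
  | cons z x ih =>
    obtain ⟨f, hf, hsum, hcard⟩ := ih fun w hw => hx w (Multiset.mem_cons_of_mem hw)
    have hz : (z ^ m) ^ ℓ = 1 := by
      rw [← pow_mul, mul_comm]
      exact hx z (Multiset.mem_cons_self z x)
    have : NeZero ℓ := ⟨hℓ.ne'⟩
    obtain ⟨i, hi, hzi⟩ := hζ.eq_pow_of_pow_eq_one hz
    have hu : (z / ζ ^ i) ^ m = 1 := by
      rw [div_pow, ← hzi, ← pow_mul, ← pow_mul, mul_comm i m, div_self (pow_ne_zero _ hζ0)]
    refine ⟨Function.update f i ((z / ζ ^ i) ::ₘ f i), fun j w hw => ?_, ?_, ?_⟩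
    · by_cases hj : j = i
      · subst hj
        rw [Function.update_self] at hw
        rcases Multiset.mem_cons.mp hw with rfl | hw
        · exact hu
        · exact hf _ _ hw
      · rw [Function.update_of_ne hj] at hw
        exact hf _ _ hw
    · have hmem : i ∈ Finset.range ℓ := Finset.mem_range.mpr hi
      rw [Multiset.sum_cons, hsum, ← Finset.add_sum_erase _ _ hmem, ← Finset.add_sum_erase _ _ hmem,
        Function.update_self, Multiset.sum_cons, add_mul,
        div_mul_cancel₀ _ (pow_ne_zero _ hζ0), add_assoc]
      congr 2
      refine Finset.sum_congr rfl fun j hj => ?_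
      rw [Function.update_of_ne (Finset.ne_of_mem_erase hj)]
    · have hmem : i ∈ Finset.range ℓ := Finset.mem_range.mpr hi
      rw [Multiset.card_cons, hcard, ← Finset.add_sum_erase _ _ hmem,
        ← Finset.add_sum_erase _ _ hmem, Function.update_self, Multiset.card_cons]
      have : ∑ j ∈ (Finset.range ℓ).erase i,
          (Function.update f i ((z / ζ ^ i) ::ₘ f i) j).card =
          ∑ j ∈ (Finset.range ℓ).erase i, (f j).card :=
        Finset.sum_congr rfl fun j hj => by
          rw [Function.update_of_ne (Finset.ne_of_mem_erase hj)]
      rw [this]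
      omega

open IntermediateField in
theorem multiset_sum_mem_adjoin {m : ℕ} (hm : 0 < m) {η : ℂ} (hη : IsPrimitiveRoot η m)
    (x : Multiset ℂ) (hx : ∀ z ∈ x, z ^ m = 1) : x.sum ∈ ℚ⟮η⟯ := by
  refine multiset_sum_mem _ fun z hz => ?_
  have : NeZero m := ⟨hm.ne'⟩
  obtain ⟨i, -, rfl⟩ := hη.eq_pow_of_pow_eq_one (hx z hz)
  exact pow_mem (mem_adjoin_simple_self ℚ η) i

/-- Summing the first alternative over the cosets. -/
theorem exists_mem_sum_eq_add {S : AddSubmonoid ℕ} {ℓ : ℕ} {a t : ℕ → ℕ}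
    (h : ∀ i < ℓ, ∃ r ∈ S, a i = t i + r) :
    ∃ r ∈ S, ∑ i ∈ Finset.range ℓ, a i = ∑ i ∈ Finset.range ℓ, t i + r := by
  have h' : ∀ i, ∃ r ∈ S, i < ℓ → a i = t i + r := fun i => by
    by_cases hi : i < ℓ
    · obtain ⟨r, hr, hr'⟩ := h i hi
      exact ⟨r, hr, fun _ => hr'⟩
    · exact ⟨0, S.zero_mem, fun h => absurd h hi⟩
  choose r hr hr' using h'
  refine ⟨∑ i ∈ Finset.range ℓ, r i, S.sum_mem fun i _ => hr i, ?_⟩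
  rw [← Finset.sum_add_distrib]
  exact Finset.sum_congr rfl fun i hi => hr' i (Finset.mem_range.mp hi)

theorem multiset_sum_eq_card {x : Multiset ℂ} (hx : ∀ z ∈ x, z ^ 1 = 1) : x.sum = x.card := by
  have h : x = Multiset.replicate x.card 1 :=
    Multiset.eq_replicate_card.mpr fun z hz => by simpa using hx z hz
  rw [h]
  simp

theorem equalSumsDichotomy_one (p q : ℕ) (S : AddSubmonoid ℕ) : EqualSumsDichotomy p q S 1 := by
  intro x y hx hy hxy
  rw [multiset_sum_eq_card hx, multiset_sum_eq_card hy] at hxy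
  exact Or.inl ⟨0, S.zero_mem, by exact_mod_cast hxy⟩

/-- When `ℓ ∣ m` the cosets do not interact: two equal sums are equal on every coset. -/
theorem EqualSumsDichotomy.mul_of_dvd {p q : ℕ} (hq : 1 ≤ q) {S : AddSubmonoid ℕ} {ℓ m : ℕ}
    (hℓ : ℓ.Prime) (hm : 0 < m) (hdvd : ℓ ∣ m) (h : EqualSumsDichotomy p q S m) :
    EqualSumsDichotomy p q S (ℓ * m) := by
  intro x y hx hy hxy
  have hpos : 0 < ℓ * m := Nat.mul_pos hℓ.pos hm
  have hω := Complex.isPrimitiveRoot_exp (ℓ * m) hpos.ne'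
  set ω := Complex.exp (2 * Real.pi * Complex.I / ((ℓ * m : ℕ) : ℂ))
  have hωm : IsPrimitiveRoot (ω ^ m) ℓ := hω.pow hpos (mul_comm _ _)
  have hωℓ : IsPrimitiveRoot (ω ^ ℓ) m := hω.pow hpos rfl
  obtain ⟨f, hf, hfs, hfc⟩ := exists_coset_decomposition hℓ.pos (hω.ne_zero hpos.ne') hωm x hx
  obtain ⟨g, hg, hgs, hgc⟩ := exists_coset_decomposition hℓ.pos (hω.ne_zero hpos.ne') hωm y hy
  have hfg : ∀ i < ℓ, (f i).sum = (g i).sum := by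
    intro i hi
    refine sub_eq_zero.mp (eq_zero_of_sum_mul_pow_eq_zero_of_dvd hℓ hm hdvd hω
      (fun i => (f i).sum - (g i).sum) (fun i => sub_mem
        (multiset_sum_mem_adjoin hm hωℓ _ (hf i)) (multiset_sum_mem_adjoin hm hωℓ _ (hg i)))
      ?_ i hi)
    simp only [sub_mul, Finset.sum_sub_distrib]
    rw [← hfs, ← hgs, hxy, sub_self]
  by_cases hall : ∀ i < ℓ, ∃ r ∈ S, (f i).card = (g i).card + r
  · rw [hfc, hgc]
    exact Or.inl (exists_mem_sum_eq_add hall)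
  · push Not at hall
    obtain ⟨i, hi, hne⟩ := hall
    right
    rcases h (f i) (g i) (hf i) (hg i) (hfg i hi) with ⟨r, hr, hr'⟩ | hle
    · exact absurd hr' (hne r hr)
    · have h1 : (f i).card ≤ x.card := by
        rw [hfc]
        exact Finset.single_le_sum (f := fun i => (f i).card) (fun _ _ => Nat.zero_le _)
          (Finset.mem_range.mpr hi)
      have h2 : (g i).card ≤ y.card := by
        rw [hgc]
        exact Finset.single_le_sum (f := fun i => (g i).card) (fun _ _ => Nat.zero_le _)
          (Finset.mem_range.mpr hi)
      have h3 : ((p : ℤ) - 1 - y.card) * ((q : ℤ) - 1) ≤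
          ((p : ℤ) - 1 - (g i).card) * ((q : ℤ) - 1) :=
        mul_le_mul_of_nonneg_right (by omega) (by omega)
      omega

/-- When `ℓ ∤ m`, two multisets of `ℓ * m`-th roots of unity with equal sums decompose into cosets
whose sums differ by a constant. -/
theorem exists_coset_decomposition_of_not_dvd {ℓ m : ℕ} (hℓ : ℓ.Prime) (hm : 0 < m)
    (hdvd : ¬ ℓ ∣ m) (x y : Multiset ℂ) (hx : ∀ z ∈ x, z ^ (ℓ * m) = 1)
    (hy : ∀ z ∈ y, z ^ (ℓ * m) = 1) (hxy : x.sum = y.sum) :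
    ∃ f g : ℕ → Multiset ℂ, (∀ i, ∀ z ∈ f i, z ^ m = 1) ∧ (∀ i, ∀ z ∈ g i, z ^ m = 1) ∧
      x.card = ∑ i ∈ Finset.range ℓ, (f i).card ∧ y.card = ∑ i ∈ Finset.range ℓ, (g i).card ∧
      ∀ i < ℓ, ∀ j < ℓ, (f i).sum + (g j).sum = (f j).sum + (g i).sum := by
  have hζ := Complex.isPrimitiveRoot_exp ℓ hℓ.ne_zero
  set ζ := Complex.exp (2 * Real.pi * Complex.I / (ℓ : ℂ))
  have hη := Complex.isPrimitiveRoot_exp m hm.ne'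
  have hζm : IsPrimitiveRoot (ζ ^ m) ℓ :=
    hζ.pow_of_coprime m ((Nat.Prime.coprime_iff_not_dvd hℓ).mpr hdvd).symm
  obtain ⟨f, hf, hfs, hfc⟩ := exists_coset_decomposition hℓ.pos (hζ.ne_zero hℓ.ne_zero) hζm x hx
  obtain ⟨g, hg, hgs, hgc⟩ := exists_coset_decomposition hℓ.pos (hζ.ne_zero hℓ.ne_zero) hζm y hy
  have hconst := eq_of_sum_mul_pow_eq_zero_of_not_dvd hℓ hm hdvd hη hζ
    (fun i => (f i).sum - (g i).sum) (fun i => sub_mem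
      (multiset_sum_mem_adjoin hm hη _ (hf i)) (multiset_sum_mem_adjoin hm hη _ (hg i))) (by
    simp only [sub_mul, Finset.sum_sub_distrib]
    rw [← hfs, ← hgs, hxy, sub_self])
  refine ⟨f, g, hf, hg, hfc, hgc, fun i hi j hj => ?_⟩
  have h1 := hconst i hi
  have h2 := hconst j hj
  linear_combination h1 - h2

theorem exists_eq_zero_of_sum_lt {ℓ : ℕ} {t : ℕ → ℕ} (h : ∑ i ∈ Finset.range ℓ, t i < ℓ) :
    ∃ i < ℓ, t i = 0 := by
  by_contra! hne
  have h1 : ∑ i ∈ Finset.range ℓ, 1 ≤ ∑ i ∈ Finset.range ℓ, t i :=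
    Finset.sum_le_sum fun i hi => Nat.one_le_iff_ne_zero.mpr (hne i (Finset.mem_range.mp hi))
  simp at h1
  omega

/-- For `m = 1` the coset parts are multiples of `1`, and their sizes in `x` exceed those in `y` by a
constant, which is nonnegative as soon as `y` misses a coset. -/
theorem equalSumsDichotomy_prime {p q : ℕ} (hp : p.Prime) (hq : 1 ≤ q) {S : AddSubmonoid ℕ}
    (hpS : p ∈ S) : EqualSumsDichotomy p q S p := by
  intro x y hx hy hxy
  obtain ⟨f, g, hf, hg, hfc, hgc, hfg⟩ := exists_coset_decomposition_of_not_dvd (m := 1) hp one_pos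
    (Nat.Prime.not_dvd_one hp) x y (by simpa using hx) (by simpa using hy) hxy
  rcases Nat.lt_or_ge (y.card + 1) p with hs | hs
  swap
  · right
    have : ((p : ℤ) - 1 - y.card) * ((q : ℤ) - 1) ≤ 0 :=
      mul_nonpos_of_nonpos_of_nonneg (by omega) (by omega)
    omega
  obtain ⟨i, hi, hi'⟩ := exists_eq_zero_of_sum_lt (ℓ := p) (t := fun i => (g i).card) (by omega)
  left
  refine ⟨(f i).card • p, S.nsmul_mem hpS _, ?_⟩
  have hcard : ∀ j < p, (f j).card = (f i).card + (g j).card := fun j hj => by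
    have h := hfg j hj i hi
    simp only [multiset_sum_eq_card (hf _), multiset_sum_eq_card (hg _), hi', Nat.cast_zero,
      add_zero] at h
    exact_mod_cast h
  rw [hfc, Finset.sum_congr rfl fun j hj => hcard j (Finset.mem_range.mp hj),
    Finset.sum_add_distrib, ← hgc, Finset.sum_const, Finset.card_range, smul_eq_mul, smul_eq_mul]
  ring

/-- The counting behind the step to a new prime `ℓ`: here `a i` and `t i` are the sizes of the
coset parts of `x` and `y`, and `i₀` is a coset missing in `y` on which `x` is smallest. A single
coset `j` satisfying the second alternative, with `a i₀ + t j` in place of `card y`, forces the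
second alternative for `x` and `y`, since at least `ℓ - 1 - (card y - t j)` of the other cosets are
missing in `y` and contribute at least `a i₀` each to `card x`. -/
theorem le_sum_of_le_of_forall_zero_le {p q ℓ : ℕ} (hq : 1 ≤ q) (hpq : p ≤ q) (hqℓ : q ≤ ℓ)
    (a t : ℕ → ℕ) (hs : ∑ i ∈ Finset.range ℓ, t i + 1 < p) (i₀ : ℕ)
    (hmin : ∀ i < ℓ, t i = 0 → a i₀ ≤ a i) (j : ℕ) (hj : j < ℓ)
    (hle : ((p : ℤ) - 1 - (a i₀ + t j : ℕ)) * ((q : ℤ) - 1) ≤ a j) :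
    ((p : ℤ) - 1 - (∑ i ∈ Finset.range ℓ, t i : ℕ)) * ((q : ℤ) - 1) ≤
      (∑ i ∈ Finset.range ℓ, a i : ℕ) := by
  have hjmem : j ∈ Finset.range ℓ := Finset.mem_range.mpr hj
  set u := a i₀
  have key : ∀ i < ℓ, u ≤ a i + u * t i := fun i hi => by
    rcases Nat.eq_zero_or_pos (t i) with h | h
    · have := hmin i hi h
      omega
    · exact (Nat.le_mul_of_pos_right u h).trans (Nat.le_add_left _ _)
  have hT := Finset.add_sum_erase _ t hjmem
  have hA := Finset.add_sum_erase _ a hjmem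
  have hE : u * (ℓ - 1) ≤ ∑ i ∈ (Finset.range ℓ).erase j, a i +
      u * ∑ i ∈ (Finset.range ℓ).erase j, t i := by
    rw [Finset.mul_sum, ← Finset.sum_add_distrib]
    calc u * (ℓ - 1) = ∑ i ∈ (Finset.range ℓ).erase j, u := by
          rw [Finset.sum_const, Finset.card_erase_of_mem hjmem, Finset.card_range, smul_eq_mul,
            mul_comm]
      _ ≤ _ := Finset.sum_le_sum fun i hi =>
          key i (Finset.mem_range.mp (Finset.mem_of_mem_erase hi))
  have hE' : u * ℓ ≤ ∑ i ∈ Finset.range ℓ, a i + u * ∑ i ∈ Finset.range ℓ, t i := by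
    have h1 := key j hj
    rw [← hT, ← hA, mul_add]
    have h2 : u * ℓ = u * (ℓ - 1) + u := by
      obtain ⟨ℓ', rfl⟩ : ∃ ℓ', ℓ = ℓ' + 1 := ⟨ℓ - 1, by omega⟩
      simp [mul_add]
    omega
  set s := ∑ i ∈ Finset.range ℓ, t i
  set s' := ∑ i ∈ (Finset.range ℓ).erase j, t i
  set b := ∑ i ∈ (Finset.range ℓ).erase j, a i
  have hℓ1 : ((ℓ - 1 : ℕ) : ℤ) = (ℓ : ℤ) - 1 := by omega
  zify at hE hE' hA hT hs hq hpq hqℓ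
  rw [hℓ1] at hE
  push_cast at hle ⊢
  have hu0 : (0 : ℤ) ≤ u := by positivity
  have hs'0 : (0 : ℤ) ≤ s' := by positivity
  have hs0 : (0 : ℤ) ≤ s := by positivity
  rcases le_or_gt (q : ℤ) u with hqu | hqu
  · have h1 : ((q : ℤ) - s) * q ≤ (ℓ - s) * u :=
      mul_le_mul (by omega) hqu (by omega) (by omega)
    have h2 : ((p : ℤ) - 1 - s) * (q - 1) ≤ (q - s) * q :=
      mul_le_mul (by omega) (by omega) (by omega) (by omega)
    nlinarith
  · have h1 : 0 ≤ (s' : ℤ) * (q - 1 - u) := mul_nonneg hs'0 (by omega)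
    have h2 : 0 ≤ ((ℓ : ℤ) - q) * u := mul_nonneg (by omega) hu0
    rw [← hA, ← hT]
    nlinarith

theorem EqualSumsDichotomy.mul_of_not_dvd {p q : ℕ} (hq : 1 ≤ q) (hpq : p ≤ q)
    {S : AddSubmonoid ℕ} {ℓ m : ℕ} (hℓ : ℓ.Prime) (hqℓ : q ≤ ℓ) (hℓS : ℓ ∈ S) (hm : 0 < m)
    (hdvd : ¬ ℓ ∣ m) (h : EqualSumsDichotomy p q S m) : EqualSumsDichotomy p q S (ℓ * m) := by
  intro x y hx hy hxy
  obtain ⟨f, g, hf, hg, hfc, hgc, hfg⟩ :=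
    exists_coset_decomposition_of_not_dvd hℓ hm hdvd x y hx hy hxy
  -- For `card y ≥ p - 1` the second alternative is vacuous.
  rcases Nat.lt_or_ge (y.card + 1) p with hs | hs
  swap
  · right
    have : ((p : ℤ) - 1 - y.card) * ((q : ℤ) - 1) ≤ 0 :=
      mul_nonpos_of_nonpos_of_nonneg (by omega) (by omega)
    omega
  obtain ⟨i₀, hi₀, hmin⟩ := Finset.exists_min_image
    ((Finset.range ℓ).filter fun i => (g i).card = 0) (fun i => (f i).card) (by
      obtain ⟨i, hi, hi'⟩ := exists_eq_zero_of_sum_lt (ℓ := ℓ) (t := fun i => (g i).card) (by omega)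
      exact ⟨i, Finset.mem_filter.mpr ⟨Finset.mem_range.mpr hi, hi'⟩⟩)
  rw [Finset.mem_filter, Finset.mem_range] at hi₀
  have hg0 : g i₀ = 0 := Multiset.card_eq_zero.mp hi₀.2
  have hdich : ∀ j < ℓ, (∃ r ∈ S, (f j).card = (f i₀).card + (g j).card + r) ∨
      ((p : ℤ) - 1 - ((f i₀).card + (g j).card : ℕ)) * ((q : ℤ) - 1) ≤ (f j).card := by
    intro j hj
    have h1 := h (f j) (f i₀ + g j) (hf j) (fun z hz => by
      rcases Multiset.mem_add.mp hz with hz | hz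
      · exact hf _ _ hz
      · exact hg _ _ hz) (by
      have h2 := hfg j hj i₀ hi₀.1
      rw [hg0, Multiset.sum_zero, add_zero] at h2
      rw [Multiset.sum_add, h2])
    rwa [Multiset.card_add] at h1
  by_cases hall : ∀ j < ℓ, ∃ r ∈ S, (f j).card = (f i₀).card + (g j).card + r
  · left
    obtain ⟨r, hr, hr'⟩ := exists_mem_sum_eq_add hall
    refine ⟨(f i₀).card • ℓ + r, S.add_mem (S.nsmul_mem hℓS _) hr, ?_⟩
    rw [hfc, hr', Finset.sum_add_distrib, ← hgc, Finset.sum_const, Finset.card_range]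
    simp only [smul_eq_mul]
    ring
  · push Not at hall
    obtain ⟨j, hj, hne⟩ := hall
    right
    rw [hfc, hgc]
    refine le_sum_of_le_of_forall_zero_le hq hpq hqℓ (fun i => (f i).card) (fun i => (g i).card)
      (by omega) i₀ (fun i hi hi' => hmin i (Finset.mem_filter.mpr ⟨Finset.mem_range.mpr hi, hi'⟩))
      j hj ?_
    rcases hdich j hj with ⟨r, hr, hr'⟩ | hle
    · exact absurd hr' (hne r hr)
    · exact hle

theorem equalSumsDichotomy_of_primeFactors {p q : ℕ} (hp : p.Prime) (hpq : p ≤ q)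
    {S : AddSubmonoid ℕ} (hpS : p ∈ S) (N : ℕ) (hN : 0 < N)
    (hfac : ∀ ℓ, ℓ.Prime → ℓ ∣ N → ℓ ∈ S ∧ (ℓ = p ∨ q ≤ ℓ)) : EqualSumsDichotomy p q S N := by
  have hq : 1 ≤ q := hp.one_le.trans hpq
  induction N using Nat.strong_induction_on with
  | _ N ih =>
    by_cases hex : ∃ ℓ, ℓ.Prime ∧ ℓ ∣ N ∧ q ≤ ℓ
    · obtain ⟨ℓ, hℓ, ⟨m, rfl⟩, hqℓ⟩ := hex
      have hm : 0 < m := Nat.pos_of_mul_pos_left hN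
      have hind := ih m (lt_mul_of_one_lt_left hm hℓ.one_lt) hm
        fun r hr hrm => hfac r hr (hrm.mul_left ℓ)
      by_cases hdvd : ℓ ∣ m
      · exact hind.mul_of_dvd hq hℓ hm hdvd
      · exact hind.mul_of_not_dvd hq hpq hℓ hqℓ (hfac ℓ hℓ (dvd_mul_right ℓ m)).1 hm hdvd
    · push Not at hex
      have honly : ∀ ℓ, ℓ.Prime → ℓ ∣ N → ℓ = p := fun ℓ hℓ hℓN =>
        (hfac ℓ hℓ hℓN).2.resolve_right (hex ℓ hℓ hℓN).not_ge
      rcases eq_or_ne N 1 with rfl | hN1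
      · exact equalSumsDichotomy_one p q S
      · obtain ⟨ℓ, hℓ, hℓN⟩ := Nat.exists_prime_and_dvd hN1
        obtain rfl := honly ℓ hℓ hℓN
        obtain ⟨m, rfl⟩ := hℓN
        have hm : 0 < m := Nat.pos_of_mul_pos_left hN
        by_cases hdvd : ℓ ∣ m
        · exact (ih m (lt_mul_of_one_lt_left hm hℓ.one_lt) hm
            fun r hr hrm => hfac r hr (hrm.mul_left ℓ)).mul_of_dvd hq hℓ hm hdvd
        · have hm1 : m = 1 := by
            by_contra hm1
            obtain ⟨r, hr, hrm⟩ := Nat.exists_prime_and_dvd hm1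
            exact hdvd (honly r hr (hrm.mul_left ℓ) ▸ hrm)
          rw [hm1, mul_one]
          exact equalSumsDichotomy_prime hℓ hq hpS

/-- The theorem of Lam and Leung: the number of terms in a vanishing sum of `N`-th roots of unity,
counted with multiplicity, is a sum of prime factors of `N`. -/
theorem card_mem_closure_primeFactors_of_sum_eq_zero {N : ℕ} (hN : 0 < N) (x : Multiset ℂ)
    (hx : ∀ z ∈ x, z ^ N = 1) (hsum : x.sum = 0) :
    x.card ∈ AddSubmonoid.closure (N.primeFactors : Set ℕ) := by
  set S := AddSubmonoid.closure (N.primeFactors : Set ℕ)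
  have hS : ∀ ℓ, ℓ.Prime → ℓ ∣ N → ℓ ∈ S := fun ℓ hℓ hℓN =>
    AddSubmonoid.subset_closure (Nat.mem_primeFactors.mpr ⟨hℓ, hℓN, hN.ne'⟩)
  rcases eq_or_ne N 1 with rfl | hN1
  · rcases equalSumsDichotomy_one 2 (x.card + 2) S x 0 hx (by simp) (by simpa using hsum) with
      ⟨t, ht, hxt⟩ | hle
    · rw [hxt]
      simpa using ht
    · push_cast at hle
      simp at hle
  have hp : (N.minFac).Prime := Nat.minFac_prime hN1
  by_cases hex : ∃ ℓ, ℓ.Prime ∧ ℓ ∣ N ∧ ℓ ≠ N.minFac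
  · classical
    obtain ⟨hq, hqN, hqp⟩ := Nat.find_spec hex
    have hmin := fun r (hr : r.Prime ∧ r ∣ N ∧ r ≠ N.minFac) => Nat.find_min' hex hr
    set q := Nat.find hex
    rcases equalSumsDichotomy_of_primeFactors hp (Nat.minFac_le_of_dvd hq.two_le hqN)
      (hS _ hp N.minFac_dvd) N hN (fun ℓ hℓ hℓN => ⟨hS ℓ hℓ hℓN, or_iff_not_imp_left.mpr fun h =>
        hmin ℓ ⟨hℓ, hℓN, h⟩⟩) x 0 hx (by simp) (by simpa using hsum) with ⟨t, ht, hxt⟩ | hle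
    · rw [hxt]
      simpa using ht
    · have hcop : N.minFac.gcd q = 1 := (Nat.coprime_primes hp hq).mpr (Ne.symm hqp)
      obtain ⟨a, b, hab⟩ := Nat.exists_add_mul_eq_of_gcd_dvd_of_mul_pred_le N.minFac q x.card
        (by rw [hcop]; exact one_dvd _) (by
          have h1 := hp.one_le
          have h2 := hq.one_le
          zify
          rw [Nat.pred_eq_sub_one, Nat.pred_eq_sub_one, Nat.cast_sub h1, Nat.cast_sub h2]
          simpa using hle)
      rw [← hab]
      exact S.add_mem (S.nsmul_mem (hS _ hp N.minFac_dvd) a) (S.nsmul_mem (hS _ hq hqN) b)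
  · push Not at hex
    -- A prime power: a second parameter so large that the second alternative fails.
    rcases equalSumsDichotomy_of_primeFactors (q := N.minFac + x.card + 2) hp (by omega)
      (hS _ hp N.minFac_dvd) N hN (fun ℓ hℓ hℓN => ⟨hS ℓ hℓ hℓN, Or.inl (hex ℓ hℓ hℓN)⟩) x 0 hx
      (by simp) (by simpa using hsum) with ⟨t, ht, hxt⟩ | hle
    · rw [hxt]
      simpa using ht
    · exfalso
      have h1 := hp.two_le
      push_cast at hle
      simp only [Multiset.card_zero, Nat.cast_zero, sub_zero] at hle
      nlinarith

theorem mem_natCombinations_of_mem_closure {P : Finset ℕ} {t : ℕ}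
    (h : t ∈ AddSubmonoid.closure (P : Set ℕ)) : t ∈ natCombinations P := by
  classical
  induction h using AddSubmonoid.closure_induction with
  | mem p hp =>
    refine ⟨fun i => if i = p then 1 else 0, ?_⟩
    simp [Finset.mem_coe.mp hp]
  | zero => exact ⟨0, by simp⟩
  | add a b _ _ ha hb =>
    obtain ⟨x, rfl⟩ := ha
    obtain ⟨y, rfl⟩ := hb
    exact ⟨x + y, by simp [mul_add, Finset.sum_add_distrib]⟩

/-- The permanent is a sum of `n!` roots of unity, to which the theorem of Lam and Leung applies. -/
theorem permanent_vandermonde_ne_zero_of_factorial_notMem {n : ℕ} (c : Fin n → ℂ) {N : ℕ}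
    (hN : 0 < N) (hcN : ∀ i, c i ^ N = 1) (hfac : n.factorial ∉ natCombinations N.primeFactors) :
    (Matrix.vandermonde c).transpose.permanent ≠ 0 := by
  intro hper
  refine hfac (mem_natCombinations_of_mem_closure ?_)
  have h := card_mem_closure_primeFactors_of_sum_eq_zero hN
    ((Finset.univ : Finset (Equiv.Perm (Fin n))).val.map fun σ => ∏ i, c i ^ (σ i : ℕ)) (by
      intro z hz
      obtain ⟨σ, -, rfl⟩ := Multiset.mem_map.mp hz
      rw [← Finset.prod_pow]
      refine Finset.prod_eq_one fun i _ => ?_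
      rw [← pow_mul, mul_comm, pow_mul, hcN, one_pow]) (by
      rw [← hper, Matrix.permanent]
      rfl)
  rwa [Multiset.card_map, Finset.card_val, Finset.card_univ, Fintype.card_perm,
    Fintype.card_fin] at h

/-! ### Embedding finitely generated groups with cyclic torsion into `ℂˣ` -/

theorem exists_injective_finsupp_real (n : ℕ) :
    ∃ L : (Fin n →₀ ℤ) →+ ℝ, Function.Injective L := by
  obtain ⟨v, hv⟩ := exists_linearIndependent_of_le_rank (R := ℚ) (M := ℝ) (n := n) (by
    rw [Real.rank_rat_real]
    exact (Cardinal.nat_lt_continuum n).le)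
  exact ⟨(Finsupp.linearCombination ℤ v).toAddMonoidHom, hv.restrict_scalars' ℤ⟩

/-- The free part is sent into the positive reals by the exponential of a `ℤ`-linear injection
`ℤ ^ r → ℝ`, and the cyclic torsion part to roots of unity; absolute values separate the two. -/
theorem exists_injective_mul_hom_complex {H : Type*} [AddCommGroup H] [AddGroup.FG H]
    (hH : ∀ K : AddSubgroup H, Finite K → IsAddCyclic K) :
    ∃ f : H → ℂ, Function.Injective f ∧ f 0 = 1 ∧ (∀ x, f x ≠ 0) ∧
      ∀ x y, f (x + y) = f x * f y := by
  obtain ⟨r, ι, _, p, hp, e, ⟨E⟩⟩ := AddCommGroup.equiv_free_prod_directSum_zmod H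
  have : ∀ i, NeZero (p i ^ e i) := fun i => ⟨pow_ne_zero _ (hp i).ne_zero⟩
  set T := DirectSum ι fun i => ZMod (p i ^ e i)
  have hfin : Finite T := Finite.of_equiv _ DFinsupp.equivFunOnFintype.symm
  let g : T →+ H := E.symm.toAddMonoidHom.comp (AddMonoidHom.inr _ _)
  have hg : Function.Injective g := E.symm.injective.comp fun a b hab => (Prod.mk.inj hab).2
  have hcyc : IsAddCyclic T := by
    have hK : IsAddCyclic g.range := hH _ (Finite.of_surjective _ g.rangeRestrict_surjective)
    exact isAddCyclic_of_injective g.rangeRestrict fun a b hab => hg (congrArg Subtype.val hab)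
  have : NeZero (Nat.card T) := ⟨Nat.card_pos.ne'⟩
  let z : T ≃+ ZMod (Nat.card T) := (zmodAddCyclicAddEquiv hcyc).symm
  obtain ⟨L, hL⟩ := exists_injective_finsupp_real r
  let χ : AddChar (ZMod (Nat.card T)) ℂ := ZMod.stdAddChar
  have hχ : ∀ t, ‖χ t‖ = 1 := fun t => by
    rw [show χ t = _ from ZMod.stdAddChar_apply t]
    exact Circle.norm_coe _
  refine ⟨fun x => (Real.exp (L (E x).1) : ℂ) * χ (z (E x).2), fun x y hxy => ?_, ?_, fun x => ?_,
    fun x y => ?_⟩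
  · have h1 := congrArg norm hxy
    simp only [norm_mul, hχ, mul_one, Complex.norm_real, Real.norm_eq_abs, Real.abs_exp] at h1
    have h2 := hL (Real.exp_injective h1)
    simp only [h2] at hxy
    have h3 : (E x).2 = (E y).2 := z.injective (ZMod.injective_stdAddChar (mul_left_cancel₀
      (Complex.ofReal_ne_zero.mpr (Real.exp_pos _).ne') hxy))
    exact E.injective (Prod.ext h2 h3)
  · simp
  · refine mul_ne_zero (Complex.ofReal_ne_zero.mpr (Real.exp_pos _).ne') fun h => ?_
    have := hχ (z (E x).2)
    rw [h, norm_zero] at this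
    exact zero_ne_one this
  · simp only [map_add, Prod.fst_add, Prod.snd_add, Real.exp_add, Complex.ofReal_mul,
      AddChar.map_add_eq_mul]
    ring

/-- A function `e` that restricts to an injective homomorphism from the subgroup `H` to the
multiplicative group of `ℂ`; its values off `H` are irrelevant. -/
structure IsMulEmbeddingOn {G : Type*} [AddCommGroup G] (H : AddSubgroup G) (e : G → ℂ) : Prop where
  injOn : Set.InjOn e H
  map_zero : e 0 = 1
  ne_zero : ∀ x ∈ H, e x ≠ 0
  map_add : ∀ x ∈ H, ∀ y ∈ H, e (x + y) = e x * e y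

theorem IsMulEmbeddingOn.map_nsmul {G : Type*} [AddCommGroup G] {H : AddSubgroup G} {e : G → ℂ}
    (he : IsMulEmbeddingOn H e) (m : ℕ) {x : G} (hx : x ∈ H) : e (m • x) = e x ^ m := by
  induction m with
  | zero => simp [he.map_zero]
  | succ m ih => rw [succ_nsmul, he.map_add _ (H.nsmul_mem hx m) _ hx, ih, pow_succ]

theorem exists_isMulEmbeddingOn {G : Type*} [AddCommGroup G]
    (hG : ∀ H : AddSubgroup G, Finite H → IsAddCyclic H) (s : Finset G) :
    ∃ (H : AddSubgroup G) (e : G → ℂ), (∀ x ∈ s, x ∈ H) ∧ IsMulEmbeddingOn H e := by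
  classical
  set H := AddSubgroup.closure (s : Set G)
  have hFG : AddGroup.FG H := AddGroup.closure_finset_fg s
  obtain ⟨f, hinj, h0, hne, hadd⟩ := exists_injective_mul_hom_complex (H := H) fun K hK => by
    have hK' : Finite (K.map H.subtype) :=
      Finite.of_equiv _ (K.equivMapOfInjective _ H.subtype_injective).toEquiv
    have := hG _ hK'
    exact isAddCyclic_of_injective (K.equivMapOfInjective _ H.subtype_injective).toAddMonoidHom
      (K.equivMapOfInjective _ H.subtype_injective).injective
  refine ⟨H, fun x => if hx : x ∈ H then f ⟨x, hx⟩ else 1,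
    fun x hx => AddSubgroup.subset_closure hx, ⟨fun x hx y hy hxy => ?_, ?_, fun x hx => ?_,
      fun x hx y hy => ?_⟩⟩
  · have hx' : x ∈ H := hx
    have hy' : y ∈ H := hy
    simp only [dif_pos hx', dif_pos hy'] at hxy
    exact congrArg Subtype.val (hinj hxy)
  · rw [dif_pos H.zero_mem]
    exact h0
  · rw [dif_pos hx]
    exact hne _
  · rw [dif_pos hx, dif_pos hy, dif_pos (H.add_mem hx hy), ← hadd]
    rfl

theorem permanent_vandermonde_comp_ne_zero {G : Type*} [AddCommGroup G] {H : AddSubgroup G}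
    {e : G → ℂ} (he : IsMulEmbeddingOn H e) {n : ℕ} (b : Fin n → G) (hb : ∀ i, b i ∈ H)
    (h : ((∀ i j, i ≠ j → b i ≠ b j) ∧ ∀ i, Odd (addOrderOf (b i))) ∨
      ((∀ i, IsOfFinAddOrder (b i)) ∧ n.factorial ∉ natCombinations (orderPrimes b))) :
    (Matrix.vandermonde fun i => e (b i)).transpose.permanent ≠ 0 := by
  set M := ∏ i, addOrderOf (b i) with hM
  have hbM : ∀ i, e (b i) ^ M = 1 := fun i => by
    rw [← he.map_nsmul M (hb i), addOrderOf_dvd_iff_nsmul_eq_zero.mp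
      (Finset.dvd_prod_of_mem (fun i => addOrderOf (b i)) (Finset.mem_univ i)), he.map_zero]
  rcases h with ⟨hne, hodd⟩ | ⟨hfin, hfac⟩
  · refine permanent_vandermonde_ne_zero_of_odd _ (fun i j hij => ?_) M ?_ hbM
    · by_contra h
      exact hne i j h (he.injOn (hb i) (hb j) hij)
    · exact Finset.prod_induction _ Odd (fun _ _ => Odd.mul) odd_one fun i _ => hodd i
  · have hpos : ∀ i, addOrderOf (b i) ≠ 0 := fun i => (hfin i).addOrderOf_pos.ne'
    have hM0 : M ≠ 0 := Finset.prod_ne_zero_iff.mpr fun i _ => hpos i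
    refine permanent_vandermonde_ne_zero_of_factorial_notMem _ (Nat.pos_of_ne_zero hM0) hbM ?_
    have hP : M.primeFactors = orderPrimes b := by
      ext p
      simp only [orderPrimes, Finset.mem_biUnion, Finset.mem_univ, true_and, Nat.mem_primeFactors]
      constructor
      · rintro ⟨hp, hdvd, -⟩
        obtain ⟨i, -, hi⟩ := (hp.prime.dvd_finsetProd_iff _).mp hdvd
        exact ⟨i, hp, hi, hpos i⟩
      · rintro ⟨i, hp, hi, -⟩
        exact ⟨hp, hi.trans (Finset.dvd_prod_of_mem (fun i => addOrderOf (b i))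
          (Finset.mem_univ i)), hM0⟩
    rwa [hP]

/-! ### Counting the families -/

open MvPolynomial in
/-- The number of members of a family is bounded below by the number of values of a weight `w` that
recovers the sum `∑ e (a i)` from the member determined by `a`. -/
theorem lt_ncard_of_coeff_ne_zero {G α : Type*} {n k d N : ℕ} (e : G → ℂ) (A : Fin n → Finset G)
    (hA : ∀ i, (A i).card = k + 1) (he : ∀ i, Set.InjOn e (A i)) (P : MvPolynomial (Fin n) ℂ)
    (hP : P.totalDegree ≤ d) (hN : d + N = n * k)
    (hcoeff : coeff (Finsupp.equivFunOnFinite.symm fun _ : Fin n => k)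
      (P * (∑ i, X i) ^ N) ≠ 0)
    (Fam : Set α) (hFam : Fam.Finite) (w : α → ℂ)
    (hw : ∀ a : Fin n → G, (∀ i, a i ∈ A i) → eval (fun i => e (a i)) P ≠ 0 →
      ∃ s ∈ Fam, w s = ∑ i, e (a i)) :
    N < Fam.ncard := by
  classical
  have hdeg : (Finsupp.equivFunOnFinite.symm fun _ : Fin n => k).degree = d + N := by
    rw [Finsupp.degree_eq_sum, hN]
    simp
  have h := lt_card_of_restricted_sums_mem P d N hP _ hdeg hcoeff
    (fun i => (A i).image e) (fun i => by
      rw [Finset.card_image_of_injOn (he i), hA]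
      exact Nat.lt_succ_self k) (hFam.image w).toFinset (by
      intro x hx hxP
      choose a haA hax using fun i => Finset.mem_image.mp (hx i)
      obtain rfl : (fun i => e (a i)) = x := funext hax
      obtain ⟨s, hs, hws⟩ := hw a haA hxP
      rw [Set.Finite.mem_toFinset, ← hws]
      exact Set.mem_image_of_mem w hs)
  rw [← Set.ncard_eq_toFinset_card _ (hFam.image w)] at h
  exact h.trans_le (Set.ncard_image_le hFam)

theorem finite_of_forall_exists_eq {G α : Type*} {n : ℕ} (A : Fin n → Finset G) (Fam : Set α)
    (g : (Fin n → G) → α) (h : ∀ s ∈ Fam, ∃ a : Fin n → G, (∀ i, a i ∈ A i) ∧ s = g a) :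
    Fam.Finite := by
  refine ((Set.Finite.pi' fun i => (A i).finite_toSet).image g).subset fun s hs => ?_
  obtain ⟨a, ha, rfl⟩ := h s hs
  exact Set.mem_image_of_mem g ha

theorem finsum_mem_range_eq_sum {G : Type*} {n : ℕ} {a : Fin n → G} (ha : Function.Injective a)
    (e : G → ℂ) : ∑ᶠ x ∈ Set.range a, e x = ∑ i, e (a i) := by
  rw [finsum_mem_range ha, finsum_eq_sum_of_fintype]

/-- Both families of sets in part (ii) are given by the exponents `(r, s)` equal to `(1, m)` and
`(m, 1)` in the conditions `r • a i ≠ r • a j` and `s • a i + b i ≠ s • a j + b j`. -/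
theorem lt_ncard_setFamily {G : Type*} [AddCommGroup G] {H : AddSubgroup G} {e : G → ℂ}
    (he : IsMulEmbeddingOn H e) {n k r s N : ℕ} (A : Fin n → Finset G)
    (hA : ∀ i, (A i).card = k + 1) (hAH : ∀ i, ∀ x ∈ A i, x ∈ H) (b : Fin n → G)
    (hb : ∀ i, b i ∈ H) (hN : (r + s) * n.choose 2 + N = n * k)
    (hper : (Matrix.vandermonde fun i => e (b i)).transpose.permanent ≠ 0)
    (hdet : (Matrix.of fun i j : Fin n => recipFactorial k (r * i + s * j)).det ≠ 0) :
    N < {S : Set G | ∃ a : Fin n → G, (∀ i, a i ∈ A i) ∧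
      (∀ i j, i ≠ j → r • a i ≠ r • a j ∧ s • a i + b i ≠ s • a j + b j) ∧
      S = Set.range a}.ncard := by
  refine lt_ncard_of_coeff_ne_zero e A hA (fun i => he.injOn.mono fun x hx => hAH i x hx)
    (vandermondePoly 1 r * vandermondePoly (fun i => e (b i)) s) (d := (r + s) * n.choose 2) ?_ hN
    ?_ _ (finite_of_forall_exists_eq A _ Set.range ?_) (fun S => ∑ᶠ x ∈ S, e x) ?_
  · refine (MvPolynomial.totalDegree_mul _ _).trans ?_
    rw [add_mul]
    exact add_le_add (totalDegree_vandermondePoly_le _ _) (totalDegree_vandermondePoly_le _ _)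
  · rw [coeff_vandermondePoly_mul_vandermondePoly_mul_sum_X_pow _ _ _ _ _ hN]
    exact mul_ne_zero (by exact_mod_cast Nat.factorial_ne_zero _) (mul_ne_zero hper hdet)
  · rintro S ⟨a, ha, -, rfl⟩
    exact ⟨a, ha, rfl⟩
  · intro a ha heval
    rw [map_mul] at heval
    have h1 := (eval_vandermondePoly_ne_zero_iff _ _ _).mp (left_ne_zero_of_mul heval)
    have h2 := (eval_vandermondePoly_ne_zero_iff _ _ _).mp (right_ne_zero_of_mul heval)
    have haH : ∀ i, a i ∈ H := fun i => hAH i _ (ha i)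
    have h1' : ∀ i j, i ≠ j → r • a i ≠ r • a j := fun i j hij h => hij (h1 (by
      have := congrArg e h
      rw [he.map_nsmul r (haH i), he.map_nsmul r (haH j)] at this
      simpa using this))
    refine ⟨Set.range a, ⟨a, ha, fun i j hij => ⟨h1' i j hij, fun h => hij (h2 ?_)⟩, rfl⟩,
      finsum_mem_range_eq_sum (fun i j h => ?_) e⟩
    · have := congrArg e h
      rw [he.map_add _ (H.nsmul_mem (haH i) s) _ (hb i),
        he.map_add _ (H.nsmul_mem (haH j) s) _ (hb j), he.map_nsmul s (haH i),
        he.map_nsmul s (haH j)] at this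
      simpa [mul_comm] using this
    · by_contra hij
      exact h1' i j hij (by rw [h])

theorem lt_ncard_multisetFamily {G : Type*} [AddCommGroup G] {H : AddSubgroup G} {e : G → ℂ}
    (he : IsMulEmbeddingOn H e) {n k m N : ℕ} (hmk : m * (n - 1) ≤ k) (A : Fin n → Finset G)
    (hA : ∀ i, (A i).card = k + 1) (hAH : ∀ i, ∀ x ∈ A i, x ∈ H) (b : Fin n → G)
    (hb : ∀ i, b i ∈ H) (hN : m * n.choose 2 + N = n * k) (hne : ∀ i j, i ≠ j → b i ≠ b j) :
    N < (multisetFamily A b m).ncard := by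
  refine lt_ncard_of_coeff_ne_zero e A hA (fun i => he.injOn.mono fun x hx => hAH i x hx)
    (vandermondePoly (fun i => e (b i)) m) (totalDegree_vandermondePoly_le _ _) hN ?_ _
    (finite_of_forall_exists_eq A _ (fun a => Multiset.map a Finset.univ.val) ?_)
    (fun S => (S.map e).sum) ?_
  · rw [coeff_vandermondePoly_mul_sum_X_pow _ _ _ _ hN]
    refine mul_ne_zero (Matrix.det_vandermonde_ne_zero_iff.mpr fun i j hij => ?_)
      (mul_ne_zero (by exact_mod_cast Nat.factorial_ne_zero _)
        (Finset.prod_ne_zero_iff.mpr fun i _ => ?_))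
    · by_contra h
      exact hne i j h (he.injOn (hb i) (hb j) hij)
    · rw [recipFactorial_of_le ((Nat.mul_le_mul_left m (by omega)).trans hmk)]
      exact inv_ne_zero (by exact_mod_cast Nat.factorial_ne_zero _)
  · rintro S ⟨a, ha, -, rfl⟩
    exact ⟨a, ha, rfl⟩
  · intro a ha heval
    have h2 := (eval_vandermondePoly_ne_zero_iff _ _ _).mp heval
    have haH : ∀ i, a i ∈ H := fun i => hAH i _ (ha i)
    refine ⟨Multiset.map a Finset.univ.val, ⟨a, ha, fun i j hij h => hij (h2 ?_), rfl⟩, ?_⟩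
    · have := congrArg e h
      rw [he.map_add _ (H.nsmul_mem (haH i) m) _ (hb i),
        he.map_add _ (H.nsmul_mem (haH j) m) _ (hb j), he.map_nsmul m (haH i),
        he.map_nsmul m (haH j)] at this
      simpa [mul_comm] using this
    · rw [Multiset.map_map]
      rfl

theorem theorem1p1 {G : Type*} [AddCommGroup G]
    (hG : ∀ H : AddSubgroup G, Finite H → IsAddCyclic H)
    (n k m : ℕ) (hn : 1 < n) (hk : n ≤ k) (hm : 0 < m)
    (hmk : (m : ℚ) ≤ ((k : ℚ) - 1) / ((n : ℚ) - 1))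
    (A : Fin n → Finset G) (hA : ∀ i, (A i).card = k) (b : Fin n → G) :
    ((∀ i j, i ≠ j → b i ≠ b j) →
      ((k : ℤ) - 1) * n - m * (n.choose 2 : ℤ) + 1 ≤ ((multisetFamily A b m).ncard : ℤ)) ∧
    ((((∀ i j, i ≠ j → b i ≠ b j) ∧ ∀ i, Odd (addOrderOf (b i))) ∨
        ((∀ i, IsOfFinAddOrder (b i)) ∧ n.factorial ∉ natCombinations (orderPrimes b))) →
      ((k : ℤ) - 1) * n - (m + 1) * (n.choose 2 : ℤ) < ((setFamilyOne A b m).ncard : ℤ) ∧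
      ((k : ℤ) - 1) * n - (m + 1) * (n.choose 2 : ℤ) < ((setFamilyTwo A b m).ncard : ℤ)) ∧
    ((m : ℤ) - 1) * (n.choose 2 : ℤ) ≤ ((k : ℤ) - 1) * n - (m + 1) * (n.choose 2 : ℤ) := by
  classical
  obtain ⟨κ, rfl⟩ : ∃ κ, k = κ + 1 := ⟨k - 1, by omega⟩
  have hκ : m * (n - 1) ≤ κ := by
    have hn' : (0 : ℚ) < (n : ℚ) - 1 := by
      have : (1 : ℚ) < n := by exact_mod_cast hn
      linarith
    rw [le_div_iff₀ hn'] at hmk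
    have h : ((m * (n - 1) : ℕ) : ℚ) ≤ (κ : ℚ) := by
      rw [Nat.cast_mul, Nat.cast_sub hn.le]
      push_cast at hmk ⊢
      linarith
    exact_mod_cast h
  have hchoose : 2 * n.choose 2 = n * (n - 1) := by
    rw [Nat.choose_two_right]
    exact Nat.mul_div_cancel' (Nat.even_mul_pred_self n).two_dvd
  have h2m : 2 * m * n.choose 2 ≤ n * κ := by
    calc 2 * m * n.choose 2 = n * (m * (n - 1)) := by
          rw [mul_comm 2 m, mul_assoc, hchoose]
          ring
      _ ≤ n * κ := Nat.mul_le_mul_left n hκ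
  have hm1 : (m + 1) * n.choose 2 ≤ n * κ :=
    (Nat.mul_le_mul_right _ (by omega)).trans h2m
  have hm0 : m * n.choose 2 ≤ n * κ := (Nat.mul_le_mul_right _ (by omega)).trans hm1
  obtain ⟨H, e, hH, he⟩ := exists_isMulEmbeddingOn hG
    ((Finset.univ.biUnion A) ∪ Finset.univ.image b)
  have hAH : ∀ i, ∀ x ∈ A i, x ∈ H := fun i x hx => hH x (Finset.mem_union_left _
    (Finset.mem_biUnion.mpr ⟨i, Finset.mem_univ i, hx⟩))
  have hb : ∀ i, b i ∈ H := fun i => hH _ (Finset.mem_union_right _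
    (Finset.mem_image_of_mem b (Finset.mem_univ i)))
  refine ⟨fun hne => ?_, fun h => ?_, ?_⟩
  · have h := lt_ncard_multisetFamily he hκ A hA hAH b hb (Nat.add_sub_cancel' hm0) hne
    zify [hm0] at h
    push_cast
    linarith
  · have hper := permanent_vandermonde_comp_ne_zero he b hb h
    have hdet := det_recipFactorial_ne_zero (n := n) m κ hm hκ
    constructor
    · have h1 := lt_ncard_setFamily he (r := 1) (s := m) A hA hAH b hb
        (Nat.add_sub_cancel' (by rwa [add_comm])) hper (by simpa using hdet)
      simp only [one_smul, add_comm 1 m] at h1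
      change _ < (setFamilyOne A b m).ncard at h1
      zify [hm1] at h1
      push_cast
      linarith
    · have h1 := lt_ncard_setFamily he (r := m) (s := 1) A hA hAH b hb
        (Nat.add_sub_cancel' hm1) hper (by
          rw [← Matrix.det_transpose]
          convert hdet using 3
          ext i j
          simp [add_comm])
      simp only [one_smul] at h1
      change _ < (setFamilyTwo A b m).ncard at h1
      zify [hm1] at h1
      push_cast
      linarith
  · zify at h2m
    push_cast
    linarith
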